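/- Call a function $g:[1,\infty)\to\mathbb{R}$ one that *admits an integral form* if there are measurable functions $h_1,s:(0,\infty)\to\mathbb{R}$ with $h_1\ge 0$ such that $$0<\int_0^\infty h_1(y)\,e^{-y}\bigl(1-e^{-y}\bigr)\,dy<\infty$$ and, for every $x\ge 1$, $$g(x)=\int_0^\infty h_1(y)\bigl(s(y)-e^{-xy}\bigr)\,dy ,$$ where the last integral converges as a Lebesgue integral (we then write $g=I_s(h_1)$). A real sequence $\{\mu_k\}_{k\ge 1}$ is the *expected maxima sequence* (EMS) of an integrable random variable $X$ if $\mu_k=\mathbb{E}\max\{X_1,\dots,X_k\}$ for every $k\ge 1$, where $X_1,\dots,X_k$ are independent copies of $X$; and $X$ is *non-degenerate* if it is not almost surely constant. **Corollary 3.3.** If $g:[1,\infty)\to\mathbb{R}$ admits an integral form, then the sequence $\mu_k=g(k)$, $k=1,2,\dots$, is the expected maxima sequence of an integrable non-degenerate random variable. In particular, the following functions on $[1,\infty)$ admit integral forms, and the corresponding sequences ($k=1,2,\dots$) are expected maxima sequences of integrable non-degenerate random variables: $x^\theta$ and $k^\theta$, for every $0<\theta<1$; $\log x$ and $\log k$;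 $H(x+c)$ and $H(k+c)$, for every real $c>-2$, where $H(x)=\int_0^1\frac{1-u^x}{1-u}\,du$ for $x>-1$ is the harmonic number function. -/

import Mathlib

open MeasureTheory Set

/-- `g` (of which only the restriction to `[1, ∞)` matters) is the function `I_s(h₁)`: the functions
`h₁, s` on `(0, ∞)` are measurable, `h₁ ≥ 0`,
`0 < ∫₀^∞ h₁(y) e^{-y} (1 - e^{-y}) dy < ∞`, and
`g(x) = ∫₀^∞ h₁(y) (s(y) - e^{-xy}) dy` for every `x ≥ 1`, as a convergent Lebesgue integral.

Functions on `(0, ∞)` are represented by functions on `ℝ` whose values outside `(0, ∞)` play no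
role. Measurability is `AEMeasurable` for Lebesgue measure on `(0, ∞)`, which covers both Borel and
Lebesgue measurable functions. -/
structure IsIntegralForm (g h₁ s : ℝ → ℝ) : Prop where
  aemeasurable_h₁ : AEMeasurable h₁ (volume.restrict (Ioi 0))
  aemeasurable_s : AEMeasurable s (volume.restrict (Ioi 0))
  nonneg : ∀ y, 0 < y → 0 ≤ h₁ y
  integral_pos :
    0 < ∫ y in Ioi (0 : ℝ), h₁ y * Real.exp (-y) * (1 - Real.exp (-y))
  integrable_weight :
    IntegrableOn (fun y : ℝ => h₁ y * Real.exp (-y) * (1 - Real.exp (-y))) (Ioi 0)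
  integrable_repr : ∀ x : ℝ, 1 ≤ x →
    IntegrableOn (fun y : ℝ => h₁ y * (s y - Real.exp (-(x * y)))) (Ioi 0)
  eq_integral : ∀ x : ℝ, 1 ≤ x →
    g x = ∫ y in Ioi (0 : ℝ), h₁ y * (s y - Real.exp (-(x * y)))

/-- `g : [1, ∞) → ℝ` admits an integral form. -/
def AdmitsIntegralForm (g : ℝ → ℝ) : Prop :=
  ∃ h₁ s : ℝ → ℝ, IsIntegralForm g h₁ s

/-- `E max (X₁, …, X_k)`, where `X₁, …, X_k` are independent copies of the random variable `X`
(for `k ≥ 1`), realised as the coordinate copies of `X` on the `k`-fold product of the probability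
space. -/
noncomputable def expectedMax {Ω : Type} [MeasurableSpace Ω] (P : Measure Ω) (X : Ω → ℝ)
    (k : ℕ) : ℝ :=
  ∫ ω : Fin k → Ω, ⨆ i : Fin k, X (ω i) ∂(Measure.pi fun _ : Fin k => P)

/-- The sequence `μ₁, μ₂, …` is the expected maxima sequence of some integrable non-degenerate
(that is, not almost surely constant) random variable `X`. The value `μ 0` plays no role. -/
def IsNondegenerateEMS (μ : ℕ → ℝ) : Prop :=
  ∃ (Ω : Type) (_ : MeasurableSpace Ω) (P : Measure Ω) (X : Ω → ℝ),
    IsProbabilityMeasure P ∧ Measurable X ∧ Integrable X P ∧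
    (¬ ∃ c : ℝ, ∀ᵐ ω ∂P, X ω = c) ∧
    ∀ k : ℕ, 1 ≤ k → expectedMax P X k = μ k

/-- Euler's harmonic number function `H(x) = ∫₀¹ (1 - u^x) / (1 - u) du`, for `x > -1`. -/
noncomputable def harmonicFn (x : ℝ) : ℝ :=
  ∫ u in Ioo (0 : ℝ) 1, (1 - u ^ x) / (1 - u)

/-! The variable is an explicit nondecreasing function of a uniform variable on `(0, 1)`: `X t = c +
∫ h(y) * tailKernel t y dy`, where `h` is a version of `h₁`. By monotonicity, the maximum of `X`
over `k` independent uniform points is `X` at their maximum, which lies below `exp (-y)` with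
probability `exp (-k y)`. Fubini (`integral_tailKernel_of_law`) turns the indicator of `t < exp
(-y)` into this probability, so the expected maximum is `c + ∫ h(y) (1_{y<1} - exp (-k y)) dy`; the
constant `c = ∫ h (s - 1_{y<1})` makes it `g k`. The indicator of `y < 1` replaces `s`, for which no
bound is available, by a centring that the weight `exp (-y) (1 - exp (-y))` controls. Non-degeneracy
holds because `g 2 - g 1` is the integral of `h₁` against this weight, which is positive.

The examples need explicit `h₁` and `s`: scaling for powers, Frullani for the logarithm, `u = exp
(-y)` for harmonic numbers. -/

/-! ### Kernel and weight estimates. -/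

/-- The difference of the indicators of `y < 1` and of `t < exp (-y)`. -/
noncomputable def tailKernel (t y : ℝ) : ℝ :=
  (if y < 1 then 1 else 0) - (if t < Real.exp (-y) then 1 else 0)

lemma tailKernel_mono (y : ℝ) {t u : ℝ} (htu : t ≤ u) : tailKernel t y ≤ tailKernel u y := by
  unfold tailKernel
  split_ifs <;> linarith

lemma measurable_tailKernel : Measurable (fun p : ℝ × ℝ => tailKernel p.1 p.2) := by
  unfold tailKernel
  refine Measurable.sub ?_ ?_
  · exact Measurable.ite (measurableSet_lt measurable_snd measurable_const)
      measurable_const measurable_const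
  · exact Measurable.ite (measurableSet_lt measurable_fst (by fun_prop))
      measurable_const measurable_const

lemma exp_neg_ge_third {y : ℝ} (hy : y < 1) : 1 / 3 ≤ Real.exp (-y) := by
  have h1 : Real.exp y ≤ 3 :=
    (Real.exp_le_exp.2 hy.le).trans (Real.exp_one_lt_d9.le.trans (by norm_num))
  rw [Real.exp_neg, one_div]
  exact inv_anti₀ (Real.exp_pos _) h1

lemma half_le_one_sub_exp_neg {y : ℝ} (hy : 1 ≤ y) : 1 / 2 ≤ 1 - Real.exp (-y) := by
  have h1 : 2 ≤ Real.exp y := by linarith [Real.add_one_le_exp y]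
  have : Real.exp (-y) ≤ 1 / 2 := by
    rw [Real.exp_neg, one_div]
    exact inv_anti₀ (by norm_num) h1
  linarith

lemma exp_neg_lt_one {y : ℝ} (hy : 0 < y) : Real.exp (-y) < 1 :=
  (Real.exp_lt_exp.2 (neg_lt_zero.2 hy)).trans_eq Real.exp_zero

/-- For `y < 1`, Bernoulli gives `1 - exp (-y) ^ k ≤ k (1 - exp (-y))`, and the missing factor `exp
(-y)` is at least `1/3`. For `y ≥ 1` the factor `1 - exp (-y)` is at least `1/2`. -/
lemma abs_indicator_sub_exp_le {k : ℕ} (hk : 1 ≤ k) {y : ℝ} (hy : 0 < y) :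
    |(if y < 1 then 1 else 0) - Real.exp (-(k * y))| ≤
      3 * k * (Real.exp (-y) * (1 - Real.exp (-y))) := by
  have hk' : (1 : ℝ) ≤ k := by exact_mod_cast hk
  have hlt := exp_neg_lt_one hy
  have hpos := Real.exp_pos (-y)
  have hpow : Real.exp (-(k * y)) = Real.exp (-y) ^ k := by
    rw [← Real.exp_nat_mul]; ring_nf
  split_ifs with h
  · have h3 := exp_neg_ge_third h
    have hb : 1 - k * (1 - Real.exp (-y)) ≤ Real.exp (-y) ^ k := by
      have := one_add_mul_le_pow (a := -(1 - Real.exp (-y))) (by linarith) k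
      rw [show 1 + -(1 - Real.exp (-y)) = Real.exp (-y) by ring] at this
      linarith
    rw [hpow, abs_of_nonneg (sub_nonneg.2 (pow_le_one₀ hpos.le hlt.le))]
    have : (k : ℝ) * (1 - Real.exp (-y)) * (1 / 3) ≤
        k * (1 - Real.exp (-y)) * Real.exp (-y) :=
      mul_le_mul_of_nonneg_left h3 (mul_nonneg (by linarith) (by linarith))
    linarith
  · have h2 := half_le_one_sub_exp_neg (not_lt.1 h)
    rw [zero_sub, abs_neg, abs_of_pos (Real.exp_pos _)]
    have h4 : Real.exp (-(k * y)) ≤ Real.exp (-y) := Real.exp_le_exp.2 (by nlinarith)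
    have h5 : Real.exp (-y) * (1 / 2) ≤ Real.exp (-y) * (1 - Real.exp (-y)) :=
      mul_le_mul_of_nonneg_left h2 hpos.le
    have h6 : 3 * (Real.exp (-y) * (1 - Real.exp (-y))) ≤
        3 * k * (Real.exp (-y) * (1 - Real.exp (-y))) :=
      mul_le_mul_of_nonneg_right (by linarith) (mul_nonneg hpos.le (by linarith))
    linarith

/-- The kernel is nonzero only if `y < 1` and `exp (-y) ≤ t`, or `y ≥ 1` and `t < exp (-y)`. There
the weight is at least `(1 - t) / 3`, respectively `t / 2`. -/
lemma abs_tailKernel_le {t y : ℝ} (ht : t ∈ Ioo (0 : ℝ) 1) (hy : 0 < y) :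
    |tailKernel t y| ≤ (3 / (1 - t) + 2 / t) * (Real.exp (-y) * (1 - Real.exp (-y))) := by
  obtain ⟨h0, h1⟩ := ht
  have hlt := exp_neg_lt_one hy
  have hpos := Real.exp_pos (-y)
  have ha : 0 < 3 / (1 - t) := div_pos (by norm_num) (by linarith)
  have hb : 0 < 2 / t := by positivity
  have hw : 0 ≤ Real.exp (-y) * (1 - Real.exp (-y)) := mul_nonneg hpos.le (by linarith)
  rw [add_mul]
  have hA := mul_nonneg ha.le hw
  have hB := mul_nonneg hb.le hw
  unfold tailKernel
  split_ifs with hy1 hty hty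
  · simpa using add_nonneg hA hB
  · have h3 := exp_neg_ge_third hy1
    have : 1 / 3 * (1 - t) ≤ Real.exp (-y) * (1 - Real.exp (-y)) :=
      mul_le_mul h3 (by linarith) (by linarith) hpos.le
    have h4 := mul_le_mul_of_nonneg_left this ha.le
    have h5 : 3 / (1 - t) * (1 / 3 * (1 - t)) = 1 := by
      have : 1 - t ≠ 0 := by linarith
      field_simp
    simp only [sub_zero, abs_one]
    linarith
  · have h2 := half_le_one_sub_exp_neg (not_lt.1 hy1)
    have : t * (1 / 2) ≤ Real.exp (-y) * (1 - Real.exp (-y)) :=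
      mul_le_mul hty.le h2 (by norm_num) hpos.le
    have h4 := mul_le_mul_of_nonneg_left this hb.le
    have h5 : 2 / t * (t * (1 / 2)) = 1 := by field_simp
    simp only [zero_sub, abs_neg, abs_one]
    linarith
  · simpa using add_nonneg hA hB

lemma integrableOn_mul_of_abs_le_weight {h f : ℝ → ℝ}
    (hm : AEMeasurable h (volume.restrict (Ioi 0))) (h0 : ∀ y, 0 < y → 0 ≤ h y)
    (hw : IntegrableOn (fun y : ℝ => h y * Real.exp (-y) * (1 - Real.exp (-y))) (Ioi 0))
    (hf : Measurable f) (C : ℝ)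
    (hC : ∀ y, 0 < y → |f y| ≤ C * (Real.exp (-y) * (1 - Real.exp (-y)))) :
    IntegrableOn (fun y => h y * f y) (Ioi 0) := by
  refine Integrable.mono' (hw.const_mul C) (hm.mul hf.aemeasurable).aestronglyMeasurable ?_
  filter_upwards [ae_restrict_mem measurableSet_Ioi] with y hy
  rw [Real.norm_eq_abs, abs_mul, abs_of_nonneg (h0 y hy)]
  calc h y * |f y| ≤ h y * (C * (Real.exp (-y) * (1 - Real.exp (-y)))) :=
        mul_le_mul_of_nonneg_left (hC y hy) (h0 y hy)
    _ = _ := by ring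

/-! ### Integrating the kernel against `h`. -/

section Weight

variable {h : ℝ → ℝ} (hm : Measurable h) (h0 : ∀ y, 0 ≤ h y)
  (hw : IntegrableOn (fun y : ℝ => h y * Real.exp (-y) * (1 - Real.exp (-y))) (Ioi 0))

include hm h0 hw

lemma integrableOn_mul_indicator_sub_exp {k : ℕ} (hk : 1 ≤ k) :
    IntegrableOn (fun y : ℝ => h y * ((if y < 1 then 1 else 0) - Real.exp (-(k * y))))
      (Ioi 0) :=
  integrableOn_mul_of_abs_le_weight hm.aemeasurable (fun y _ => h0 y) hw
    ((Measurable.ite measurableSet_Iio measurable_const measurable_const).sub (by fun_prop))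
    (3 * k) (fun _ hy => abs_indicator_sub_exp_le hk hy)

lemma integrableOn_mul_tailKernel {t : ℝ} (ht : t ∈ Ioo (0 : ℝ) 1) :
    IntegrableOn (fun y : ℝ => h y * tailKernel t y) (Ioi 0) :=
  integrableOn_mul_of_abs_le_weight hm.aemeasurable (fun y _ => h0 y) hw
    (measurable_tailKernel.comp (measurable_const.prodMk measurable_id)) _
    (fun _ hy => abs_tailKernel_le ht hy)

lemma monotoneOn_integral_tailKernel :
    MonotoneOn (fun t => ∫ y in Ioi (0 : ℝ), h y * tailKernel t y) (Ioo 0 1) := by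
  intro t ht u hu htu
  exact integral_mono (integrableOn_mul_tailKernel hm h0 hw ht)
    (integrableOn_mul_tailKernel hm h0 hw hu)
    (fun y => mul_le_mul_of_nonneg_left (tailKernel_mono y htu) (h0 y))

/-- If `m` is distributed as the maximum of `k` independent uniform variables on `(0, 1)`, then
Fubini's theorem computes the expectation of `∫ h(y) tailKernel(m, y) dy`. -/
lemma integral_tailKernel_of_law {Ω : Type*} [MeasurableSpace Ω] (Q : Measure Ω)
    [IsProbabilityMeasure Q] {m : Ω → ℝ} (hmm : Measurable m) {k : ℕ} (hk : 1 ≤ k)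
    (hQ : ∀ y, 0 < y → Q.real {ω | m ω < Real.exp (-y)} = Real.exp (-(k * y))) :
    Integrable (fun ω => ∫ y in Ioi (0 : ℝ), h y * tailKernel (m ω) y) Q ∧
    ∫ ω, (∫ y in Ioi (0 : ℝ), h y * tailKernel (m ω) y) ∂Q =
      ∫ y in Ioi (0 : ℝ), h y * ((if y < 1 then 1 else 0) - Real.exp (-(k * y))) := by
  have hset : ∀ y, MeasurableSet {ω | m ω < Real.exp (-y)} := fun y =>
    measurableSet_lt hmm measurable_const
  have hind : ∀ y : ℝ, (fun ω => (if m ω < Real.exp (-y) then (1 : ℝ) else 0)) =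
      {ω | m ω < Real.exp (-y)}.indicator 1 := by
    intro y; ext ω; simp [indicator]
  have hint1 : ∀ y : ℝ, Integrable (fun ω => (if m ω < Real.exp (-y) then (1 : ℝ) else 0)) Q := by
    intro y
    rw [hind]
    exact (integrable_const (1 : ℝ)).indicator (hset y)
  have hintK : ∀ y, Integrable (fun ω => h y * tailKernel (m ω) y) Q := fun y =>
    ((integrable_const _).sub (hint1 y)).const_mul _
  have hK : ∀ y, 0 < y → ∫ ω, h y * tailKernel (m ω) y ∂Q =
      h y * ((if y < 1 then 1 else 0) - Real.exp (-(k * y))) := by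
    intro y hy
    unfold tailKernel
    rw [integral_const_mul, integral_sub (integrable_const _) (hint1 y), hind,
      integral_indicator_one (hset y), hQ y hy]
    simp
  -- For fixed `y` the sign of the kernel depends only on whether `y < 1`, so the norm passes
  -- through the integral over `ω`; this gives absolute integrability on the product.
  have hnorm : ∀ y, 0 < y → ∫ ω, ‖h y * tailKernel (m ω) y‖ ∂Q =
      ‖h y * ((if y < 1 then 1 else 0) - Real.exp (-(k * y)))‖ := by
    intro y hy
    rw [← hK y hy]
    by_cases hy1 : y < 1
    · have hs : ∀ ω, 0 ≤ h y * tailKernel (m ω) y := by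
        intro ω
        refine mul_nonneg (h0 y) ?_
        unfold tailKernel
        split_ifs <;> norm_num
      rw [Real.norm_of_nonneg (integral_nonneg hs)]
      exact integral_congr_ae (.of_forall fun ω => Real.norm_of_nonneg (hs ω))
    · have hs : ∀ ω, h y * tailKernel (m ω) y ≤ 0 := by
        intro ω
        refine mul_nonpos_of_nonneg_of_nonpos (h0 y) ?_
        unfold tailKernel
        split_ifs <;> norm_num
      rw [Real.norm_of_nonpos (integral_nonpos hs), ← integral_neg]
      exact integral_congr_ae (.of_forall fun ω => Real.norm_of_nonpos (hs ω))
  have hmeas : Measurable (fun p : Ω × ℝ => h p.2 * tailKernel (m p.1) p.2) :=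
    (hm.comp measurable_snd).mul
      (measurable_tailKernel.comp ((hmm.comp measurable_fst).prodMk measurable_snd))
  have hprod : Integrable (fun p : Ω × ℝ => h p.2 * tailKernel (m p.1) p.2)
      (Q.prod (volume.restrict (Ioi 0))) := by
    rw [integrable_prod_iff' hmeas.aestronglyMeasurable]
    refine ⟨.of_forall hintK, ?_⟩
    refine (integrableOn_mul_indicator_sub_exp hm h0 hw hk).norm.congr ?_
    filter_upwards [ae_restrict_mem measurableSet_Ioi] with y hy
    exact (hnorm y hy).symm
  refine ⟨hprod.integral_prod_left, ?_⟩
  rw [integral_integral_swap hprod]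
  exact setIntegral_congr_fun measurableSet_Ioi fun y hy => hK y hy

end Weight

/-! ### Maxima of independent uniform variables. -/

lemma volume_restrict_real_Iio {a : ℝ} (h0 : 0 ≤ a) (h1 : a ≤ 1) :
    (volume.restrict (Ioo (0 : ℝ) 1)).real (Iio a) = a := by
  rw [measureReal_restrict_apply measurableSet_Iio]
  have : Iio a ∩ Ioo (0 : ℝ) 1 = Ioo 0 a := by
    ext x; simp only [mem_inter_iff, mem_Iio, mem_Ioo]; constructor
    · rintro ⟨ha, hb, -⟩; exact ⟨hb, ha⟩
    · rintro ⟨ha, hb⟩; exact ⟨hb, ha, hb.trans_le h1⟩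
  rw [this]
  simp [h0]

instance isProbabilityMeasure_restrict_Ioo :
    IsProbabilityMeasure (volume.restrict (Ioo (0 : ℝ) 1)) := ⟨by simp⟩

lemma pi_real_iSup_lt {P : Measure ℝ} [IsProbabilityMeasure P] {k : ℕ} (hk : 1 ≤ k) (a : ℝ) :
    (Measure.pi fun _ : Fin k => P).real {ω | ⨆ i, ω i < a} = P.real (Iio a) ^ k := by
  have : Nonempty (Fin k) := ⟨⟨0, hk⟩⟩
  have : {ω : Fin k → ℝ | ⨆ i, ω i < a} = univ.pi fun _ => Iio a := by
    ext ω
    simp only [mem_ofPred_eq, mem_pi, mem_univ, true_implies, mem_Iio]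
    constructor
    · intro h i
      exact (le_ciSup (finite_range ω).bddAbove i).trans_lt h
    · intro h
      obtain ⟨i, hi⟩ := exists_eq_ciSup_of_finite (f := ω)
      rw [← hi]; exact h i
  rw [this, measureReal_def, Measure.pi_pi]
  simp [measureReal_def]

lemma MonotoneOn.map_iSup_of_finite {ι : Type*} [Finite ι] [Nonempty ι] {X : ℝ → ℝ} {s : Set ℝ}
    (hX : MonotoneOn X s) {ω : ι → ℝ} (hω : ∀ i, ω i ∈ s) : ⨆ i, X (ω i) = X (⨆ i, ω i) := by
  obtain ⟨j, hj⟩ := exists_eq_ciSup_of_finite (f := ω)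
  rw [← hj]
  refine le_antisymm (ciSup_le fun i => hX (hω i) (hω j) ?_)
    (le_ciSup (finite_range fun i => X (ω i)).bddAbove j)
  rw [hj]
  exact le_ciSup (finite_range ω).bddAbove i

lemma ae_pi_forall {Ω : Type*} [MeasurableSpace Ω] (P : Measure Ω) [IsProbabilityMeasure P]
    {k : ℕ} {p : Ω → Prop} (hp : ∀ᵐ x ∂P, p x) :
    ∀ᵐ ω ∂(Measure.pi fun _ : Fin k => P), ∀ i, p (ω i) := by
  rw [ae_all_iff]
  intro i
  exact (Measure.tendsto_eval_ae_ae (μ := fun _ : Fin k => P) (i := i)).eventually hp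

lemma expectedMax_of_ae_eq_const {Ω : Type} [MeasurableSpace Ω] (P : Measure Ω)
    [IsProbabilityMeasure P] {X : Ω → ℝ} {c : ℝ} (hc : ∀ᵐ ω ∂P, X ω = c) {k : ℕ} (hk : 1 ≤ k) :
    expectedMax P X k = c := by
  have : Nonempty (Fin k) := ⟨⟨0, hk⟩⟩
  have : ∀ᵐ ω ∂(Measure.pi fun _ : Fin k => P), ⨆ i, X (ω i) = c := by
    filter_upwards [ae_pi_forall P hc] with ω hω
    simp [hω]
  rw [expectedMax, integral_congr_ae this]
  simp

/-! ### From an integral form to a random variable. -/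

theorem IsIntegralForm.isNondegenerateEMS {g h₁ s : ℝ → ℝ} (H : IsIntegralForm g h₁ s) :
    IsNondegenerateEMS (fun k : ℕ => g (k : ℝ)) := by
  -- The absolute value of a measurable version is measurable and nonnegative everywhere, and still
  -- agrees with `h₁` almost everywhere on `(0, ∞)`.
  set h : ℝ → ℝ := fun y => |H.aemeasurable_h₁.mk h₁ y| with hh
  have hm : Measurable h := H.aemeasurable_h₁.measurable_mk.abs
  have h0 : ∀ y, 0 ≤ h y := fun y => abs_nonneg _
  have hae : h₁ =ᵐ[volume.restrict (Ioi 0)] h := by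
    filter_upwards [H.aemeasurable_h₁.ae_eq_mk, ae_restrict_mem measurableSet_Ioi] with y hy hy0
    rw [hh]
    simp only [← hy, abs_of_nonneg (H.nonneg y hy0)]
  have hcongr : ∀ f : ℝ → ℝ, (fun y => h₁ y * f y) =ᵐ[volume.restrict (Ioi 0)]
      fun y => h y * f y := fun f => by
    filter_upwards [hae] with y hy
    rw [hy]
  have hw : IntegrableOn (fun y : ℝ => h y * Real.exp (-y) * (1 - Real.exp (-y))) (Ioi 0) :=
    H.integrable_weight.congr <| by
      filter_upwards [hae] with y hy
      rw [hy]
  have hs : ∀ k : ℕ, 1 ≤ k →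
      IntegrableOn (fun y : ℝ => h y * (s y - Real.exp (-(k * y)))) (Ioi 0) := fun k hk =>
    (H.integrable_repr k (by exact_mod_cast hk)).congr (hcongr _)
  have hg : ∀ k : ℕ, 1 ≤ k → g k = ∫ y in Ioi (0 : ℝ), h y * (s y - Real.exp (-(k * y))) :=
    fun k hk => (H.eq_integral k (by exact_mod_cast hk)).trans (integral_congr_ae (hcongr _))
  -- The exponentials cancel between the representation at `k = 1` and the centred one.
  have hS : IntegrableOn (fun y : ℝ => h y * (s y - if y < 1 then 1 else 0)) (Ioi 0) := by
    refine ((hs 1 le_rfl).sub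
      (integrableOn_mul_indicator_sub_exp hm h0 hw le_rfl)).congr (.of_forall fun y => ?_)
    simp only [Pi.sub_apply]
    ring
  set c := ∫ y in Ioi (0 : ℝ), h y * (s y - if y < 1 then 1 else 0) with hc
  have hgc : ∀ k : ℕ, 1 ≤ k → g k = c +
      ∫ y in Ioi (0 : ℝ), h y * ((if y < 1 then 1 else 0) - Real.exp (-(k * y))) := by
    intro k hk
    rw [hg k hk, hc, ← integral_add hS (integrableOn_mul_indicator_sub_exp hm h0 hw hk)]
    congr 1; ext y; ring
  set P : Measure ℝ := volume.restrict (Ioo (0 : ℝ) 1) with hP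
  set X : ℝ → ℝ := fun t => c + ∫ y in Ioi (0 : ℝ), h y * tailKernel t y with hX
  have hXm : Measurable X := by
    refine measurable_const.add (StronglyMeasurable.measurable ?_)
    refine StronglyMeasurable.integral_prod_right'
      (f := fun p : ℝ × ℝ => h p.2 * tailKernel p.1 p.2) ?_
    exact ((hm.comp measurable_snd).mul measurable_tailKernel).stronglyMeasurable
  have hXmono : MonotoneOn X (Ioo 0 1) := fun t ht u hu htu =>
    add_le_add le_rfl (monotoneOn_integral_tailKernel hm h0 hw ht hu htu)
  have hlaw : ∀ y : ℝ, 0 < y → P.real (Iio (Real.exp (-y))) = Real.exp (-y) := fun y hy =>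
    volume_restrict_real_Iio (Real.exp_pos _).le (exp_neg_lt_one hy).le
  have hXi : Integrable X P :=
    (integrable_const c).add (integral_tailKernel_of_law hm h0 hw P measurable_id le_rfl
      (fun y hy => by rw [Nat.cast_one, one_mul]; exact hlaw y hy)).1
  have hmax : ∀ k : ℕ, 1 ≤ k → expectedMax P X k = g k := by
    intro k hk
    have : Nonempty (Fin k) := ⟨⟨0, hk⟩⟩
    have hF := integral_tailKernel_of_law hm h0 hw (Measure.pi fun _ : Fin k => P)
      (m := fun ω => ⨆ i, ω i) (Measurable.iSup fun i => measurable_pi_apply i) hk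
      (fun y hy => by
        rw [pi_real_iSup_lt hk, hlaw y hy, ← Real.exp_nat_mul]; ring_nf)
    have hsup : ∀ᵐ ω ∂(Measure.pi fun _ : Fin k => P), ⨆ i, X (ω i) = X (⨆ i, ω i) := by
      filter_upwards [ae_pi_forall P (ae_restrict_mem measurableSet_Ioo)] with ω hω
      exact hXmono.map_iSup_of_finite hω
    rw [expectedMax, integral_congr_ae hsup, hX, integral_add (integrable_const c) hF.1, hF.2,
      hgc k hk]
    simp
  refine ⟨ℝ, inferInstance, P, X, inferInstance, hXm, hXi, ?_, hmax⟩
  rintro ⟨b, hb⟩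
  -- A constant variable has equal first and second expected maxima, which contradicts
  -- `integral_pos`.
  have h12 : g (2 : ℕ) - g (1 : ℕ) = 0 := by
    rw [← hmax 2 (by norm_num), ← hmax 1 le_rfl, expectedMax_of_ae_eq_const P hb (by norm_num),
      expectedMax_of_ae_eq_const P hb le_rfl, sub_self]
  have hpos := H.integral_pos
  rw [H.eq_integral _ (by norm_num), H.eq_integral _ (by norm_num),
    ← integral_sub (H.integrable_repr _ (by norm_num)) (H.integrable_repr _ (by norm_num))] at h12
  have heq : ∀ y : ℝ, h₁ y * (s y - Real.exp (-((2 : ℕ) * y))) -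
      h₁ y * (s y - Real.exp (-((1 : ℕ) * y))) = h₁ y * Real.exp (-y) * (1 - Real.exp (-y)) := by
    intro y
    have : Real.exp (-((2 : ℕ) * y)) = Real.exp (-y) * Real.exp (-y) := by
      rw [← Real.exp_add]; push_cast; ring_nf
    rw [this]; push_cast; rw [one_mul]; ring
  simp only [heq] at h12
  exact hpos.ne' h12

/-! ### Powers and the logarithm. -/

lemma setIntegral_Ioi_pos {f : ℝ → ℝ} {a : ℝ} (hf : IntegrableOn f (Ioi a))
    (hpos : ∀ y ∈ Ioi a, 0 < f y) : 0 < ∫ y in Ioi a, f y := by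
  rw [setIntegral_pos_iff_support_of_nonneg_ae _ hf]
  · have hsub : Ioi a ⊆ Function.support f := fun y hy => (hpos y hy).ne'
    rw [inter_eq_right.2 hsub]
    simp
  · filter_upwards [ae_restrict_mem measurableSet_Ioi] with y hy
    exact (hpos y hy).le

/-- Subtracting the integrand at `x = 1` from that at `x = 2` leaves exactly the weighted `h₁`, so
the weight conditions follow from the representation once `h₁ > 0`. -/
lemma isIntegralForm_of_pos {g h₁ s : ℝ → ℝ}
    (hm : AEMeasurable h₁ (volume.restrict (Ioi 0)))
    (sm : AEMeasurable s (volume.restrict (Ioi 0)))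
    (hpos : ∀ y, 0 < y → 0 < h₁ y)
    (hi : ∀ x : ℝ, 1 ≤ x → IntegrableOn (fun y : ℝ => h₁ y * (s y - Real.exp (-(x * y)))) (Ioi 0))
    (hg : ∀ x : ℝ, 1 ≤ x → g x = ∫ y in Ioi (0 : ℝ), h₁ y * (s y - Real.exp (-(x * y)))) :
    IsIntegralForm g h₁ s := by
  have hw : IntegrableOn (fun y : ℝ => h₁ y * Real.exp (-y) * (1 - Real.exp (-y))) (Ioi 0) := by
    refine ((hi 2 (by norm_num)).sub (hi 1 le_rfl)).congr (.of_forall fun y => ?_)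
    have : Real.exp (-(2 * y)) = Real.exp (-y) * Real.exp (-y) := by
      rw [← Real.exp_add]; ring_nf
    simp only [Pi.sub_apply, this, one_mul]
    ring
  have hwpos : ∀ y ∈ Ioi (0 : ℝ), 0 < h₁ y * Real.exp (-y) * (1 - Real.exp (-y)) := by
    intro y hy
    refine mul_pos (mul_pos (hpos y hy) (Real.exp_pos _)) (sub_pos.2 (exp_neg_lt_one hy))
  exact ⟨hm, sm, fun y hy => (hpos y hy).le, setIntegral_Ioi_pos hw hwpos, hw, hi, hg⟩

lemma one_sub_exp_neg_le (y : ℝ) : 1 - Real.exp (-y) ≤ y := by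
  linarith [Real.add_one_le_exp (-y)]

lemma integrableOn_rpow_mul_one_sub_exp {θ : ℝ} (h0 : 0 < θ) (h1 : θ < 1) :
    IntegrableOn (fun y : ℝ => y ^ (-θ - 1) * (1 - Real.exp (-y))) (Ioi 0) := by
  have hmeas : Measurable (fun y : ℝ => y ^ (-θ - 1) * (1 - Real.exp (-y))) := by fun_prop
  rw [← Ioc_union_Ioi_eq_Ioi zero_le_one]
  refine IntegrableOn.union ?_ ?_
  · have hI : IntegrableOn (fun y : ℝ => y ^ (-θ)) (Ioc 0 1) :=
      (intervalIntegrable_iff_integrableOn_Ioc_of_le zero_le_one).1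
        (intervalIntegral.intervalIntegrable_rpow' (by linarith))
    refine Integrable.mono' hI hmeas.aestronglyMeasurable ?_
    filter_upwards [ae_restrict_mem measurableSet_Ioc] with y hy
    have hy0 : 0 < y := hy.1
    have he : Real.exp (-y) ≤ 1 := Real.exp_le_one_iff.2 (by linarith)
    rw [Real.norm_of_nonneg (mul_nonneg (by positivity) (by linarith))]
    calc y ^ (-θ - 1) * (1 - Real.exp (-y)) ≤ y ^ (-θ - 1) * y :=
          mul_le_mul_of_nonneg_left (one_sub_exp_neg_le y) (by positivity)
      _ = y ^ (-θ) := by rw [← Real.rpow_add_one hy0.ne']; ring_nf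
  · refine Integrable.mono' (integrableOn_Ioi_rpow_of_lt (a := -θ - 1) (by linarith) one_pos)
      hmeas.aestronglyMeasurable ?_
    filter_upwards [ae_restrict_mem measurableSet_Ioi] with y hy
    have hy0 : 0 < y := zero_lt_one.trans hy
    have he : Real.exp (-y) ≤ 1 := Real.exp_le_one_iff.2 (by linarith)
    rw [Real.norm_of_nonneg (mul_nonneg (by positivity) (by linarith))]
    exact mul_le_of_le_one_right (by positivity) (by linarith [Real.exp_pos (-y)])

/-- With `s = 1` and `h₁` a multiple of `y ^ (-θ - 1)`, the substitution `y ↦ x y` pulls out the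
factor `x ^ θ`; dividing by `C`, the integral at `x = 1`, normalises it. -/
theorem admitsIntegralForm_rpow {θ : ℝ} (h0 : 0 < θ) (h1 : θ < 1) :
    AdmitsIntegralForm (fun x : ℝ => x ^ θ) := by
  set F : ℝ → ℝ := fun y => y ^ (-θ - 1) * (1 - Real.exp (-y)) with hF
  have hFi : IntegrableOn F (Ioi 0) := integrableOn_rpow_mul_one_sub_exp h0 h1
  have hFpos : ∀ y ∈ Ioi (0 : ℝ), 0 < F y := fun y hy =>
    mul_pos (Real.rpow_pos_of_pos hy _) (sub_pos.2 (exp_neg_lt_one hy))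
  set C : ℝ := ∫ y in Ioi (0 : ℝ), F y with hC
  have hCpos : 0 < C := setIntegral_Ioi_pos hFi hFpos
  have hscale : ∀ x : ℝ, 0 < x → ∀ y ∈ Ioi (0 : ℝ),
      x ^ (θ + 1) * C⁻¹ * F (x * y) = C⁻¹ * y ^ (-θ - 1) * (1 - Real.exp (-(x * y))) := by
    intro x hx y hy
    have : x ^ (θ + 1) * x ^ (-θ - 1) = 1 := by
      rw [← Real.rpow_add hx]; ring_nf; exact Real.rpow_zero x
    simp only [hF]
    rw [Real.mul_rpow hx.le (le_of_lt hy)]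
    linear_combination (C⁻¹ * y ^ (-θ - 1) * (1 - Real.exp (-(x * y)))) * this
  refine ⟨fun y => C⁻¹ * y ^ (-θ - 1), fun _ => 1, isIntegralForm_of_pos
    (by fun_prop) aemeasurable_const
    (fun y hy => mul_pos (inv_pos.2 hCpos) (Real.rpow_pos_of_pos hy _)) ?_ ?_⟩
  · intro x hx
    have hx0 : 0 < x := zero_lt_one.trans_le hx
    refine IntegrableOn.congr_fun ?_ (hscale x hx0) measurableSet_Ioi
    refine Integrable.const_mul ?_ _
    have := integrableOn_Ioi_comp_mul_left_iff F 0 hx0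
    rw [mul_zero] at this
    exact this.2 hFi
  · intro x hx
    have hx0 : 0 < x := zero_lt_one.trans_le hx
    rw [← setIntegral_congr_fun measurableSet_Ioi (hscale x hx0), integral_const_mul,
      integral_comp_mul_left_Ioi F 0 hx0, mul_zero, ← hC, Real.rpow_add_one hx0.ne', smul_eq_mul]
    field_simp

theorem admitsIntegralForm_log : AdmitsIntegralForm (fun x : ℝ => Real.log x) := by
  have hi : ∀ x : ℝ, 1 ≤ x →
      IntegrableOn (fun y : ℝ => y⁻¹ * (Real.exp (-y) - Real.exp (-(x * y)))) (Ioi 0) := by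
    intro x hx
    refine Integrable.mono' ((integrableOn_exp_neg_Ioi 0).const_mul (x - 1))
      (Measurable.aestronglyMeasurable (by fun_prop)) ?_
    filter_upwards [ae_restrict_mem measurableSet_Ioi] with y hy
    have hy0 : 0 < y := hy
    have hle : Real.exp (-(x * y)) ≤ Real.exp (-y) := Real.exp_le_exp.2 (by nlinarith)
    rw [Real.norm_of_nonneg (mul_nonneg (by positivity) (by linarith))]
    have h1 : Real.exp (-(x * y)) = Real.exp (-y) * Real.exp (-((x - 1) * y)) := by
      rw [← Real.exp_add]; ring_nf
    have h2 := one_sub_exp_neg_le ((x - 1) * y)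
    rw [h1, inv_mul_le_iff₀ hy0]
    nlinarith [Real.exp_pos (-y)]
  refine ⟨fun y => y⁻¹, fun y => Real.exp (-y), isIntegralForm_of_pos
    (by fun_prop) (by fun_prop) (fun y hy => inv_pos.2 hy) hi ?_⟩
  intro x hx
  -- Frullani for `exp (-y)`, whose limits at `0` and `∞` are `1` and `0`.
  have hF := Frullani.integral_Ioi_eq (f := fun y : ℝ => Real.exp (-y)) (a := 1) (b := x)
    (L := 1) (R := 0)
    ((Continuous.locallyIntegrable (by fun_prop)).locallyIntegrableOn _) one_pos
    (zero_lt_one.trans_le hx)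
    (tendsto_nhdsWithin_of_tendsto_nhds
      (Continuous.tendsto' (by fun_prop) _ _ (by simp)))
    (Real.tendsto_exp_neg_atTop_nhds_zero)
    (by simpa using hi x hx)
  simpa using hF.symm

/-! ### Harmonic numbers. -/

/-- The substitution `u = exp (-y)`. -/
lemma harmonicFn_eq_integral (a : ℝ) : harmonicFn a =
    ∫ y in Ioi (0 : ℝ), Real.exp (-y) * ((1 - Real.exp (-(a * y))) / (1 - Real.exp (-y))) := by
  have himg : (fun y : ℝ => Real.exp (-y)) '' Ioi 0 = Ioo 0 1 := by
    ext u
    constructor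
    · rintro ⟨y, hy, rfl⟩
      exact ⟨Real.exp_pos _, exp_neg_lt_one hy⟩
    · rintro ⟨hu0, hu1⟩
      exact ⟨-Real.log u, by simpa using Real.log_neg hu0 hu1, by simp [Real.exp_log hu0]⟩
  have hinj : InjOn (fun y : ℝ => Real.exp (-y)) (Ioi 0) := fun y _ z _ h => by
    simpa using h
  rw [harmonicFn, ← himg, integral_image_eq_integral_abs_deriv_smul measurableSet_Ioi
    (f' := fun y => -Real.exp (-y)) (fun y _ => by
      simpa using ((hasDerivAt_id y).neg.exp).hasDerivWithinAt) hinj]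
  refine setIntegral_congr_fun measurableSet_Ioi fun y _ => ?_
  simp only [abs_neg, abs_of_pos (Real.exp_pos _), smul_eq_mul, ← Real.exp_mul]
  ring_nf

/-- Bernoulli is applied with exponent `a + 1` rather than `a`, since it needs an exponent at least
`1`. -/
lemma one_sub_exp_neg_mul_le {a y : ℝ} (ha : 0 ≤ a) (hy : 0 < y) :
    1 - Real.exp (-(a * y)) ≤ (a + 1) * (1 - Real.exp (-y)) := by
  have hb : 1 + (a + 1) * (Real.exp (-y) - 1) ≤ Real.exp (-((a + 1) * y)) := by
    have := one_add_mul_self_le_rpow_one_add (s := Real.exp (-y) - 1)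
      (by linarith [Real.exp_pos (-y)]) (p := a + 1) (by linarith)
    rw [add_sub_cancel, ← Real.exp_mul] at this
    convert! this using 2
    ring
  have : Real.exp (-((a + 1) * y)) ≤ Real.exp (-(a * y)) := Real.exp_le_exp.2 (by nlinarith)
  linarith

/-- The dominating function is `(a + 1) exp (-y)` for `a ≥ 0` and `exp (-(1 + a) y)` for `-1 < a <
0`. -/
lemma integrableOn_harmonic_integrand {a : ℝ} (ha : -1 < a) :
    IntegrableOn (fun y : ℝ =>
      Real.exp (-y) * ((1 - Real.exp (-(a * y))) / (1 - Real.exp (-y)))) (Ioi 0) := by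
  have hmeas : Measurable (fun y : ℝ =>
      Real.exp (-y) * ((1 - Real.exp (-(a * y))) / (1 - Real.exp (-y)))) := by fun_prop
  have hden : ∀ y ∈ Ioi (0 : ℝ), 0 < 1 - Real.exp (-y) := fun y hy =>
    sub_pos.2 (exp_neg_lt_one hy)
  rcases le_or_gt 0 a with h0 | h0
  · refine Integrable.mono' ((integrableOn_exp_neg_Ioi 0).const_mul (a + 1))
      hmeas.aestronglyMeasurable ?_
    filter_upwards [ae_restrict_mem measurableSet_Ioi] with y hy
    have hy0 : 0 < y := hy
    have hn : 0 ≤ 1 - Real.exp (-(a * y)) :=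
      sub_nonneg.2 (Real.exp_le_one_iff.2 (by nlinarith))
    rw [Real.norm_of_nonneg (mul_nonneg (Real.exp_pos _).le (div_nonneg hn (hden y hy).le)),
      mul_comm]
    exact mul_le_mul_of_nonneg_right
      ((div_le_iff₀ (hden y hy)).2 (one_sub_exp_neg_mul_le h0 hy0)) (Real.exp_pos _).le
  · refine Integrable.mono' (exp_neg_integrableOn_Ioi 0 (b := 1 + a) (by linarith))
      hmeas.aestronglyMeasurable ?_
    filter_upwards [ae_restrict_mem measurableSet_Ioi] with y hy
    have hy0 : 0 < y := hy
    have hn : 0 ≤ Real.exp (-(a * y)) - 1 :=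
      sub_nonneg.2 (Real.one_le_exp (by nlinarith))
    have hle : Real.exp (-(a * y)) - 1 ≤ Real.exp (-(a * y)) * (1 - Real.exp (-y)) := by
      have : Real.exp (-(a * y)) * Real.exp (-y) ≤ 1 := by
        rw [← Real.exp_add]; exact Real.exp_le_one_iff.2 (by nlinarith)
      linarith
    rw [norm_mul, norm_div, Real.norm_of_nonneg (Real.exp_pos _).le,
      Real.norm_of_nonneg (hden y hy).le, norm_sub_rev, Real.norm_of_nonneg hn]
    calc Real.exp (-y) * ((Real.exp (-(a * y)) - 1) / (1 - Real.exp (-y)))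
        ≤ Real.exp (-y) * Real.exp (-(a * y)) :=
          mul_le_mul_of_nonneg_left ((div_le_iff₀ (hden y hy)).2 hle) (Real.exp_pos _).le
      _ = Real.exp (-(1 + a) * y) := by rw [← Real.exp_add]; ring_nf

/-- Factoring `exp (-((c + 1) y)) / (1 - exp (-y))` out of the integrand isolates `exp (-(x y))` and
leaves `s = exp (c y)`. The bound on `c` ensures `x + c > -1` for every `x ≥ 1`. -/
theorem admitsIntegralForm_harmonicFn {c : ℝ} (hc : -2 < c) :
    AdmitsIntegralForm (fun x : ℝ => harmonicFn (x + c)) := by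
  have heq : ∀ x y : ℝ, Real.exp (-y) * ((1 - Real.exp (-((x + c) * y))) / (1 - Real.exp (-y))) =
      Real.exp (-((c + 1) * y)) / (1 - Real.exp (-y)) *
        (Real.exp (c * y) - Real.exp (-(x * y))) := by
    intro x y
    have h1 : Real.exp (-((c + 1) * y)) * Real.exp (c * y) = Real.exp (-y) := by
      rw [← Real.exp_add]; ring_nf
    have h2 : Real.exp (-((c + 1) * y)) * Real.exp (-(x * y)) =
        Real.exp (-y) * Real.exp (-((x + c) * y)) := by
      rw [← Real.exp_add, ← Real.exp_add]; ring_nf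
    rw [div_mul_eq_mul_div, mul_sub, h1, h2]
    ring
  refine ⟨fun y => Real.exp (-((c + 1) * y)) / (1 - Real.exp (-y)), fun y => Real.exp (c * y),
    isIntegralForm_of_pos (Measurable.aemeasurable (by fun_prop)) (by fun_prop)
      (fun y hy => div_pos (Real.exp_pos _) (sub_pos.2 (exp_neg_lt_one hy)))
      ?_ ?_⟩
  · intro x hx
    simp only [← heq]
    exact integrableOn_harmonic_integrand (by linarith)
  · intro x _
    simp only [← heq]
    exact harmonicFn_eq_integral (x + c)

theorem corollary3p3 :
    (∀ g : ℝ → ℝ, AdmitsIntegralForm g → IsNondegenerateEMS (fun k : ℕ => g (k : ℝ))) ∧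
    (∀ θ : ℝ, 0 < θ → θ < 1 →
      AdmitsIntegralForm (fun x : ℝ => x ^ θ) ∧
      IsNondegenerateEMS (fun k : ℕ => (k : ℝ) ^ θ)) ∧
    (AdmitsIntegralForm (fun x : ℝ => Real.log x) ∧
      IsNondegenerateEMS (fun k : ℕ => Real.log (k : ℝ))) ∧
    (∀ c : ℝ, -2 < c →
      AdmitsIntegralForm (fun x : ℝ => harmonicFn (x + c)) ∧
      IsNondegenerateEMS (fun k : ℕ => harmonicFn ((k : ℝ) + c))) := by
  have key : ∀ g : ℝ → ℝ, AdmitsIntegralForm g → IsNondegenerateEMS (fun k : ℕ => g (k : ℝ)) :=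
    fun g ⟨_, _, H⟩ => H.isNondegenerateEMS
  exact ⟨key,
    fun θ h0 h1 => ⟨admitsIntegralForm_rpow h0 h1, key _ (admitsIntegralForm_rpow h0 h1)⟩,
    ⟨admitsIntegralForm_log, key _ admitsIntegralForm_log⟩,
    fun c hc => ⟨admitsIntegralForm_harmonicFn hc, key _ (admitsIntegralForm_harmonicFn hc)⟩⟩
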